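/- Let $\mathcal H=L^2(\mathbf T^2)$ be the real Hilbert space of square-integrable real functions on the two-dimensional torus. Let $\mathcal L$ be a (possibly unbounded) densely defined operator on $\mathcal H$ with $\mathcal L^*=-\mathcal L$, and let $e^{-t\mathcal L}$, $t\ge 0$, be the forward solution operator of $\partial_t v+\mathcal L v=0$, i.e. the strongly continuous semigroup generated by $-\mathcal L$. Write $e^{-t\mathcal L^*}$ for the adjoint of $e^{-t\mathcal L}$. Fix $\Delta t>0$ and put $t_n=n\Delta t$. Let $v_0$ be an $\mathcal H$-valued random variable with Gaussian law $\mathcal N(m_0,\mathcal C_0)$, and let $\{\eta_n\}_{n\in\mathbb N}$ be i.i.d. $\mathcal H$-valued random variables with Gaussian law $\mathcal N(0,\Gamma)$. Assume that $v_0$ and $\{\eta_n\}_{n\in\mathbb N}$ are independent of one another, and that $\mathcal C_0$ and $\Gamma$ are strictly positive, i.e. $\langle \mathcal C_0x,x\rangle>0$ and $\langle\Gamma x,x\rangle>0$ for all $x\ne0$. Put $v_n=e^{-t_n\mathcal L}v_0$, $y_n=v_n+\eta_n$ for $n\ge1$, and $Y_n=(y_1,\dots,y_n)$. Then for every $n\ge0$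 the (regular) conditional distribution $\mathbb P(v_n\mid Y_n)$ is almost surely a Gaussian measure $\mathcal N(m^n,\mathcal C^n)$, whose mean $m^n$ is a measurable function of $Y_n$ and whose covariance operator $\mathcal C^n$ is deterministic. With $m^0=m_0$, $\mathcal C^0=\mathcal C_0$, they satisfy, for every $n\ge0$ (the first identity almost surely), $$m^{n+1}=e^{-\Delta t\mathcal L}m^n-\mathcal P_n\,(\Gamma+\mathcal P_n)^{-1}\bigl(e^{-\Delta t\mathcal L}m^n-y_{n+1}\bigr),$$ $$\mathcal C^{n+1}=\mathcal P_n-\mathcal P_n\,(\Gamma+\mathcal P_n)^{-1}\mathcal P_n,$$ where $\mathcal P_n=e^{-\Delta t\mathcal L}\,\mathcal C^n\,e^{-\Delta t\mathcal L^*}$. Here $\Gamma+\mathcal P_n$ is injective with unbounded inverse, and in both identities $\mathcal P_n(\Gamma+\mathcal P_n)^{-1}$, which is a priori defined on the range of $\Gamma+\mathcal P_n$, stands for its measurable linear extension with respect to $\mathcal N(0,\Gamma+\mathcal P_n)$: a linear extension that is defined and measurable on a measurable linear subspace of full $\mathcal N(0,\Gamma+\mathcal P_n)$-measure (it is unique up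 to null sets). This subspace contains the range of $\mathcal P_n$ and, almost surely, the vector $e^{-\Delta t\mathcal L}m^n-y_{n+1}$. -/

import Mathlib

open MeasureTheory ProbabilityTheory Filter Topology

namespace KalmanFilter

section Spaces

/-- The two-dimensional torus, with its normalised Haar (Lebesgue) measure. -/
abbrev Torus2 : Type := UnitAddTorus (Fin 2)

/-- The real Hilbert space of square-integrable real functions on the two-dimensional torus. -/
abbrev L2Torus : Type := Lp ℝ 2 (volume : Measure Torus2)

noncomputable instance instMeasurableSpaceL2Torus : MeasurableSpace L2Torus := borel L2Torus

instance instBorelSpaceL2Torus : BorelSpace L2Torus := ⟨rfl⟩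

instance instSecondCountableTopologyL2Torus : SecondCountableTopology L2Torus :=
  haveI : Fact ((2 : ENNReal) ≠ ⊤) := ⟨ENNReal.ofNat_ne_top⟩
  inferInstance

end Spaces

section Evolution

variable {H : Type*} [NormedAddCommGroup H] [InnerProductSpace ℝ H] [CompleteSpace H]

/-- A (possibly unbounded) operator is anti-Hermitian if it is densely defined and its Hilbert
space adjoint, domain included, is its negative. -/
def IsAntiHermitian (L : H →ₗ.[ℝ] H) : Prop :=
  Dense (L.domain : Set H) ∧ L.adjoint = -L

/-- `U t`, `t ≥ 0`, is a strongly continuous semigroup of bounded operators whose infinitesimal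
generator (with its full domain) is `A`. -/
structure IsSemigroupGeneratedBy (A : H →ₗ.[ℝ] H) (U : ℝ → H →L[ℝ] H) : Prop where
  zero : U 0 = ContinuousLinearMap.id ℝ H
  add : ∀ s t : ℝ, 0 ≤ s → 0 ≤ t → U (s + t) = (U s).comp (U t)
  continuous : ∀ x : H, ContinuousOn (fun t : ℝ => U t x) (Set.Ici 0)
  generator : ∀ x y : H, (x, y) ∈ A.graph ↔
    Tendsto (fun t : ℝ => t⁻¹ • (U t x - x)) (𝓝[>] 0) (𝓝 y)

open Classical in
/-- The forward solution operator `e^{-tL}`, for `t ≥ 0`, of the equation `∂ₜ v + L v = 0`: the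
value at time `t` of the strongly continuous semigroup generated by `-L`. A strongly continuous
semigroup is determined by its generator, and for an anti-Hermitian `L` it exists (Stone's
theorem), so the default value `id` never occurs for such `L`. -/
noncomputable def solutionOperator (L : H →ₗ.[ℝ] H) (t : ℝ) : H →L[ℝ] H :=
  if h : ∃ U : ℝ → H →L[ℝ] H, IsSemigroupGeneratedBy (-L) U then h.choose t
  else ContinuousLinearMap.id ℝ H

end Evolution

section Gaussian

variable {H : Type*} [NormedAddCommGroup H] [InnerProductSpace ℝ H] [MeasurableSpace H]

/-- `μ` is the Gaussian measure `N(m, C)`: all its one-dimensional projections are Gaussian, its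
mean is `m` and its covariance operator is `C`. -/
structure IsGaussianWith (μ : Measure H) (m : H) (C : H →L[ℝ] H) : Prop where
  gaussian : IsGaussian μ
  mean : ∀ l : H, ∫ x, inner ℝ l x ∂μ = inner ℝ l m
  covariance : ∀ k l : H,
    ∫ x, inner ℝ k (x - m) * inner ℝ l (x - m) ∂μ = inner ℝ k (C l)

/-- Strict positivity of a covariance operator. -/
def IsStrictlyPositive (C : H →L[ℝ] H) : Prop :=
  ∀ x : H, x ≠ 0 → 0 < inner ℝ (C x) x

/-- For an injective bounded operator `S`, the operator `P S⁻¹` with its natural domain, the range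
of `S`. In infinite dimensions `S⁻¹` is unbounded if `S` is a covariance operator. -/
noncomputable def mulInv (P S : H →L[ℝ] H) : H →ₗ.[ℝ] H :=
  (P : H →ₗ[ℝ] H).compPMap ((S : H →ₗ[ℝ] H).toPMap ⊤).inverse

/-- `K` is a measurable linear extension of `T` with respect to the Gaussian measure `N(0, S)`:
a linear operator extending `T`, defined on a measurable linear subspace of full
`N(0, S)`-measure, and measurable there. If the domain of `T` is the range of `S`, then such
a `K` is unique up to `N(0, S)`-null sets. -/
structure IsMeasurableLinearExtension (S : H →L[ℝ] H) (T K : H →ₗ.[ℝ] H) : Prop where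
  extends_map : T ≤ K
  measurableSet_domain : MeasurableSet (K.domain : Set H)
  measurable_map : Measurable (fun x : K.domain => K x)
  full_measure : ∃ ν : Measure H, IsGaussianWith ν 0 S ∧ ν ((K.domain : Set H)ᶜ) = 0

end Gaussian

section Filtering

variable {H : Type*} [NormedAddCommGroup H] [InnerProductSpace ℝ H] [CompleteSpace H]
variable {Ω : Type*}

/-- The signal `v_n = e^{-t_n L} v₀` at time `t_n = n Δt`. -/
noncomputable def signal (L : H →ₗ.[ℝ] H) (Δt : ℝ) (v₀ : Ω → H) (n : ℕ) (ω : Ω) : H :=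
  solutionOperator L (n * Δt) (v₀ ω)

/-- The observation `y_n = v_n + η_n`. -/
noncomputable def observation (L : H →ₗ.[ℝ] H) (Δt : ℝ) (v₀ : Ω → H) (η : ℕ → Ω → H)
    (n : ℕ) (ω : Ω) : H :=
  signal L Δt v₀ n ω + η n ω

/-- The data `Y_n = (y_1, …, y_n)`. -/
noncomputable def data (L : H →ₗ.[ℝ] H) (Δt : ℝ) (v₀ : Ω → H) (η : ℕ → Ω → H)
    (n : ℕ) (ω : Ω) : Fin n → H :=
  fun i => observation L Δt v₀ η (i + 1) ω

/-- The predicted covariance `e^{-Δt L} C e^{-Δt L*}`, where `e^{-Δt L*}` is the adjoint of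
`e^{-Δt L}`. -/
noncomputable def predictedCov (L : H →ₗ.[ℝ] H) (Δt : ℝ) (C : H →L[ℝ] H) : H →L[ℝ] H :=
  (solutionOperator L Δt).comp (C.comp (ContinuousLinearMap.adjoint (solutionOperator L Δt)))

end Filtering

end KalmanFilter

/-!
The proof follows the estimation error `v_n - m^n(Y_n)` instead of the conditional distributions:
the claim maintained along the recursion (`IsFilterAt`) is that the error is independent of the data
`Y_n` and has the law `N(0, C^n)`. Translating that law by `m^n(Y_n)` gives the conditional
distribution (`condDistrib_ae_eq_map_add`).

For one step, the error is transported by `e^{-Δt L}` to a vector `ξ` with law `N(0, P_n)`. Together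
with the new noise `η` it is independent of the old data, and the innovation is `z = ξ + η`.
So everything reduces to the regression of `ξ` on `z` (`exists_gaussian_regression`). Project `ξ` in
`L²(Ω; H)` onto the closure of the vectors `B z`, with `B` a bounded operator. The projection `N` is
a limit of some `B_j z`, almost surely along a subsequence, and the operator `K` is the
pointwise limit of the `B_j` on the measurable subspace where it exists. Three facts carry the
argument.

* Writing covariances through `pairing F k = ⟨k, F⟩ ∈ L²(Ω)`, one has
  `B_j (Γ + P) x = (pairing (B_j z))† (pairing z x)` and
  `B_j P x = (pairing (B_j z))† (pairing ξ x)`. Both converge in norm, the first to `P x`, which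
  makes `K` an extension of `P (Γ + P)⁻¹`, and the second to `P x - C' x`, where `C'` is the
  covariance of `ξ - N`.
* The rank-one operators are among the `B`, so every component of `ξ - N` is uncorrelated with every
  component of `z`.
* Mean-square limits of Gaussian variables are Gaussian (`hasGaussianLaw_of_tendsto`), so
  `(ξ - N, z)` is jointly Gaussian, and uncorrelated means independent.

Neither a basis nor a spectral decomposition of the covariances is needed, and of the evolution only
the semigroup law of `e^{-tL}` enters.
-/

/-! ### Independence and conditional distributions -/

namespace KalmanFilter

section Independence

variable {Ω α β γ : Type*} [MeasurableSpace Ω] [MeasurableSpace α] [MeasurableSpace β]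
  [MeasurableSpace γ] {Prob : Measure Ω} [IsProbabilityMeasure Prob]

theorem indepFun_prodMk_assoc {X : Ω → α} {Y : Ω → β} {Z : Ω → γ} (hX : Measurable X)
    (hY : Measurable Y) (hZ : Measurable Z) (hXY : IndepFun X Y Prob)
    (hXYZ : IndepFun (fun ω => (X ω, Y ω)) Z Prob) :
    IndepFun X (fun ω => (Y ω, Z ω)) Prob := by
  have hYZ : IndepFun Y Z Prob := hXYZ.comp measurable_snd measurable_id
  have : IsProbabilityMeasure (Prob.map X) := Measure.isProbabilityMeasure_map hX.aemeasurable
  have : IsProbabilityMeasure (Prob.map Y) := Measure.isProbabilityMeasure_map hY.aemeasurable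
  have : IsProbabilityMeasure (Prob.map Z) := Measure.isProbabilityMeasure_map hZ.aemeasurable
  rw [indepFun_iff_map_prod_eq_prod_map_map (by fun_prop) (by fun_prop)] at hXY hXYZ hYZ ⊢
  have key : Prob.map (fun ω => (X ω, (Y ω, Z ω)))
      = (Prob.map (fun ω => ((X ω, Y ω), Z ω))).map MeasurableEquiv.prodAssoc := by
    rw [Measure.map_map (by fun_prop) (by fun_prop)]
    rfl
  rw [key, hXYZ, hXY, hYZ]
  exact (measurePreserving_prodAssoc _ _ _).map_eq

/-- If `X = f (Y) + R` with `R` independent of `Y`, then the conditional law of `X` given `Y = y` is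
the law of `R` translated by `f y`. -/
theorem condDistrib_ae_eq_map_add {E : Type*} [AddGroup E] [MeasurableSpace E] [MeasurableAdd₂ E]
    [StandardBorelSpace E] [Nonempty E] {X R : Ω → E} {Y : Ω → β} {f : β → E} (hY : Measurable Y)
    (hR : Measurable R) (hf : Measurable f) (hX : ∀ ω, X ω = f (Y ω) + R ω)
    (hRY : IndepFun R Y Prob) :
    ∀ᵐ ω ∂Prob, condDistrib X Y Prob (Y ω) = (Prob.map R).map (fun x => f (Y ω) + x) := by
  have : IsProbabilityMeasure (Prob.map R) := Measure.isProbabilityMeasure_map hR.aemeasurable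
  have : IsProbabilityMeasure (Prob.map Y) := Measure.isProbabilityMeasure_map hY.aemeasurable
  have hX' : X = fun ω => f (Y ω) + R ω := funext hX
  have hadd : Measurable (fun p : β × E => f p.1 + p.2) := by fun_prop
  let κ : Kernel β E := (Kernel.id ×ₖ Kernel.const β (Prob.map R)).map (fun p => f p.1 + p.2)
  have hκ : ∀ y, κ y = (Prob.map R).map (fun x => f y + x) := by
    intro y
    rw [Kernel.map_apply _ hadd, Kernel.prod_apply, Kernel.id_apply, Kernel.const_apply,
      Measure.dirac_prod, Measure.map_map hadd (by fun_prop)]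
    rfl
  have : IsMarkovKernel κ := Kernel.IsMarkovKernel.map _ hadd
  have hmeas : Measurable X := by rw [hX']; fun_prop
  have key : Prob.map (fun ω => (Y ω, X ω)) = Prob.map Y ⊗ₘ κ := by
    have h1 : Prob.map (fun ω => (Y ω, X ω))
        = (Prob.map (fun ω => (Y ω, R ω))).map (fun p => (p.1, f p.1 + p.2)) := by
      rw [Measure.map_map (by fun_prop) (by fun_prop), hX']
      rfl
    rw [h1, (indepFun_iff_map_prod_eq_prod_map_map hY.aemeasurable hR.aemeasurable).1 hRY.symm]
    ext s hs
    rw [Measure.map_apply (by fun_prop) hs, Measure.compProd_apply hs,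
      Measure.prod_apply (hs.preimage (by fun_prop))]
    refine lintegral_congr fun y => ?_
    rw [hκ, Measure.map_apply (by fun_prop) (hs.preimage (by fun_prop))]
    rfl
  have h := condDistrib_ae_eq_of_measure_eq_compProd Y hmeas.aemeasurable key
  filter_upwards [ae_of_ae_map hY.aemeasurable h] with ω hω
  rw [hω, hκ]

end Independence

end KalmanFilter

/-! ### Linear regression in mean square and Gaussian limits -/

namespace KalmanFilter

section SecondOrder

variable {H : Type*} [NormedAddCommGroup H] [InnerProductSpace ℝ H]
variable {Ω : Type*} [MeasurableSpace Ω] {Prob : Measure Ω}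

variable (Prob) in
/-- The map sending a square-integrable random vector `F` to the operator `k ↦ ⟨k, F⟩` from `H` to
the square-integrable random variables, continuous in both arguments. -/
noncomputable def pairing : Lp H 2 Prob →L[ℝ] H →L[ℝ] Lp ℝ 2 Prob :=
  ((innerSL ℝ : H →L[ℝ] H →L[ℝ] ℝ).compLpL₂ 2 Prob).flip

theorem coeFn_pairing (F : Lp H 2 Prob) (k : H) :
    pairing Prob F k =ᵐ[Prob] fun ω => inner ℝ k (F ω) :=
  ContinuousLinearMap.coeFn_compLp (innerSL ℝ k) F

theorem inner_pairing (F G : Lp H 2 Prob) (k l : H) :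
    inner ℝ (pairing Prob F k) (pairing Prob G l)
      = ∫ ω, inner ℝ k (F ω) * inner ℝ l (G ω) ∂Prob := by
  rw [L2.inner_def]
  refine integral_congr_ae ?_
  filter_upwards [coeFn_pairing F k, coeFn_pairing G l] with ω h1 h2
  simp [h1, h2, mul_comm]

theorem pairing_compLp [CompleteSpace H] (B : H →L[ℝ] H) (F : Lp H 2 Prob) (k : H) :
    pairing Prob (B.compLp F) k = pairing Prob F (ContinuousLinearMap.adjoint B k) := by
  refine Lp.ext ?_
  filter_upwards [coeFn_pairing (B.compLp F) k, coeFn_pairing F (ContinuousLinearMap.adjoint B k),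
    B.coeFn_compLp F] with ω h1 h2 h3
  rw [h1, h2, h3, ContinuousLinearMap.adjoint_inner_left]

/-- Orthogonality to all rank-one images `⟨l, G⟩ k` of a random vector `G` means that all
components are uncorrelated with those of `G`. -/
theorem inner_compLp_rankOne (F G : Lp H 2 Prob) (k l : H) :
    inner ℝ F (((innerSL ℝ l).smulRight k).compLp G)
      = inner ℝ (pairing Prob F k) (pairing Prob G l) := by
  rw [L2.inner_def, inner_pairing]
  refine integral_congr_ae ?_
  filter_upwards [ContinuousLinearMap.coeFn_compLp ((innerSL ℝ l).smulRight k) G] with ω h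
  rw [h]
  simp [real_inner_smul_right, real_inner_comm k, mul_comm]

variable [CompleteSpace H]

/-- The orthogonal projection, in the square-integrable random vectors, of `F` onto the closure of
the vectors `B G` with `B` a bounded operator. It is a limit of such vectors, and the remainder is
componentwise uncorrelated with `G`. -/
theorem exists_linear_regression (F G : Lp H 2 Prob) :
    ∃ (N : Lp H 2 Prob) (B : ℕ → H →L[ℝ] H),
      Tendsto (fun n => (B n).compLp G) atTop (𝓝 N) ∧
      ∀ k l, inner ℝ (pairing Prob (F - N) k) (pairing Prob G l) = 0 := by
  let Φ : (H →L[ℝ] H) →ₗ[ℝ] Lp H 2 Prob :=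
    { toFun := fun B => B.compLp G
      map_add' := fun B B' => ContinuousLinearMap.add_compLp B B' G
      map_smul' := fun c B => ContinuousLinearMap.smul_compLp c B G }
  let W : Submodule ℝ (Lp H 2 Prob) := (LinearMap.range Φ).topologicalClosure
  have : CompleteSpace W := (LinearMap.range Φ).isClosed_topologicalClosure.completeSpace_coe
  have hN : W.starProjection F ∈ closure (Set.range Φ) := by
    have h : W.starProjection F ∈ W := W.starProjection_apply_mem F
    have h' : W.starProjection F ∈ (W : Set (Lp H 2 Prob)) := h
    rwa [Submodule.topologicalClosure_coe, LinearMap.coe_range] at h'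
  obtain ⟨u, hu, hlim⟩ := mem_closure_iff_seq_limit.1 hN
  choose B hB using hu
  refine ⟨W.starProjection F, B, ?_, fun k l => ?_⟩
  · exact hlim.congr fun n => (hB n).symm
  · rw [← inner_compLp_rankOne]
    refine W.starProjection_inner_eq_zero F _ ?_
    exact (LinearMap.range Φ).le_topologicalClosure ⟨(innerSL ℝ l).smulRight k, rfl⟩

end SecondOrder

section GaussianLimit

variable {Ω : Type*} [MeasurableSpace Ω] {Prob : Measure Ω} [IsProbabilityMeasure Prob]

theorem continuous_integral_Lp_two : Continuous fun f : Lp ℝ 2 Prob => ∫ ω, f ω ∂Prob := by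
  have h : (fun f : Lp ℝ 2 Prob => ∫ ω, f ω ∂Prob)
      = fun f =>
        inner ℝ (indicatorConstLp 2 MeasurableSet.univ (measure_ne_top Prob _) (1 : ℝ)) f := by
    funext f
    rw [L2.inner_indicatorConstLp_one]
    simp
  rw [h]
  fun_prop

theorem variance_Lp_two (f : Lp ℝ 2 Prob) :
    Var[f; Prob] = inner ℝ f f - (∫ ω, f ω ∂Prob) ^ 2 := by
  rw [variance_eq_sub (Lp.memLp f), L2.inner_def]
  congr 1
  refine integral_congr_ae (Eventually.of_forall fun ω => ?_)
  simp [pow_two]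

/-- A mean-square limit of Gaussian random variables is Gaussian. -/
theorem hasGaussianLaw_of_tendsto {f : ℕ → Lp ℝ 2 Prob} {g : Lp ℝ 2 Prob}
    (hf : ∀ n, HasGaussianLaw (f n) Prob) (h : Tendsto f atTop (𝓝 g)) :
    HasGaussianLaw g Prob := by
  have hg : AEMeasurable g Prob := (Lp.aestronglyMeasurable g).aemeasurable
  rw [hasGaussianLaw_iff_charFun_map_eq hg]
  intro t
  obtain ⟨ns, hns, hae⟩ := (tendstoInMeasure_of_tendsto_Lp h).exists_seq_tendsto_ae
  have hsub : Tendsto (fun j => t • f (ns j)) atTop (𝓝 (t • g)) :=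
    (h.comp hns.tendsto_atTop).const_smul t
  have hcf : ∀ u : Lp ℝ 2 Prob, charFun (Prob.map u) t
      = ∫ ω, Complex.exp ((inner ℝ (u ω) t : ℝ) * Complex.I) ∂Prob := fun u => by
    rw [charFun_apply, integral_map (Lp.aestronglyMeasurable u).aemeasurable]
    exact Continuous.aestronglyMeasurable (by fun_prop)
  -- the Gaussian formula as a function of `t • u` in `L²`
  have hmv : ∀ u : Lp ℝ 2 Prob,
      Complex.exp (((∫ ω, (fun ω => inner ℝ t (u ω)) ω ∂Prob : ℝ) : ℂ) * Complex.I
        - ((Var[fun ω => inner ℝ t (u ω); Prob] : ℝ) : ℂ) / 2)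
      = Complex.exp (((∫ ω, (t • u : Lp ℝ 2 Prob) ω ∂Prob : ℝ) : ℂ) * Complex.I
        - ((inner ℝ (t • u) (t • u) - (∫ ω, (t • u : Lp ℝ 2 Prob) ω ∂Prob) ^ 2 : ℝ) : ℂ) / 2) := by
    intro u
    have hae : (fun ω => inner ℝ t (u ω)) =ᵐ[Prob] (t • u : Lp ℝ 2 Prob) := by
      filter_upwards [Lp.coeFn_smul t u] with ω hω
      rw [hω]
      simp [mul_comm]
    rw [← variance_Lp_two, variance_congr hae]
    simp only []
    rw [integral_congr_ae hae]
  -- The characteristic functions converge both by dominated convergence and, as the Gaussian formula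
  -- depends continuously on mean and variance, to the Gaussian one.
  have hlim1 : Tendsto (fun j => charFun (Prob.map (f (ns j))) t) atTop
      (𝓝 (charFun (Prob.map g) t)) := by
    simp_rw [hcf]
    refine tendsto_integral_of_dominated_convergence (fun _ => (1 : ℝ)) (fun j => ?_)
      (integrable_const _) (fun j => ?_) ?_
    · have := Lp.aestronglyMeasurable (f (ns j))
      exact (show Continuous fun x : ℝ => Complex.exp ((inner ℝ x t : ℝ) * Complex.I) by
        fun_prop).comp_aestronglyMeasurable this
    · exact Eventually.of_forall fun ω => (Complex.norm_exp_ofReal_mul_I _).le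
    · filter_upwards [hae] with ω hω
      exact ((show Continuous fun x : ℝ => Complex.exp ((inner ℝ x t : ℝ) * Complex.I) by
        fun_prop).tendsto _).comp hω
  have hlim2 : Tendsto (fun j => charFun (Prob.map (f (ns j))) t) atTop
      (𝓝 (Complex.exp (((∫ ω, (fun ω => inner ℝ t (g ω)) ω ∂Prob : ℝ) : ℂ) * Complex.I
        - ((Var[fun ω => inner ℝ t (g ω); Prob] : ℝ) : ℂ) / 2))) := by
    rw [hmv g]
    refine Tendsto.congr (fun j => ((hf (ns j)).charFun_map_eq t).symm) ?_
    simp_rw [hmv]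
    have hc : Continuous fun u : Lp ℝ 2 Prob =>
        Complex.exp (((∫ ω, u ω ∂Prob : ℝ) : ℂ) * Complex.I
          - ((inner ℝ u u - (∫ ω, u ω ∂Prob) ^ 2 : ℝ) : ℂ) / 2) := by
      have := continuous_integral_Lp_two (Prob := Prob)
      fun_prop
    exact (hc.tendsto _).comp hsub
  exact tendsto_nhds_unique hlim1 hlim2

end GaussianLimit

end KalmanFilter

/-! ### Gaussian regression and its measurable linear gain -/

namespace KalmanFilter

section PartialOperators

variable {H : Type*} [NormedAddCommGroup H] [InnerProductSpace ℝ H]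

/-- Injectivity of `S` makes `LinearPMap.inverse` the actual inverse, defined on the range of `S`. -/
theorem mulInv_le {P S : H →L[ℝ] H} (hS : Function.Injective S) {K : H →ₗ.[ℝ] H}
    (h : ∀ x, ∃ hx : S x ∈ K.domain, K ⟨S x, hx⟩ = P x) : mulInv P S ≤ K := by
  have hker : ((S : H →ₗ[ℝ] H).toPMap ⊤).toFun.ker = ⊥ := by
    rw [LinearMap.ker_eq_bot]
    intro x y hxy
    exact Subtype.ext (hS hxy)
  have hdom : ∀ y ∈ (mulInv P S).domain, ∃ x, S x = y := by
    intro y hy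
    have hy' : y ∈ ((S : H →ₗ[ℝ] H).toPMap ⊤).inverse.domain := hy
    rw [LinearPMap.inverse_domain] at hy'
    obtain ⟨x, hx⟩ := hy'
    exact ⟨x, hx⟩
  refine ⟨fun y hy => ?_, fun y z hyz => ?_⟩
  · obtain ⟨x, rfl⟩ := hdom y hy
    exact (h x).1
  · obtain ⟨y, hy⟩ := y
    obtain ⟨z, hz⟩ := z
    obtain ⟨x, rfl⟩ := hdom y hy
    obtain rfl : S x = z := hyz
    rw [(h x).2]
    have hinv := LinearPMap.inverse_apply_eq hker
      (y := ⟨S x, hy⟩) (x := ⟨x, Submodule.mem_top⟩) rfl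
    exact congrArg P hinv

/-- The pointwise limit of a sequence of bounded operators, on the subspace where it exists. The
limit is written with `limUnder`, which also provides a total measurable extension. -/
noncomputable def pointwiseLimit (B : ℕ → H →L[ℝ] H) : H →ₗ.[ℝ] H where
  domain :=
    { carrier := {x | ∃ c, Tendsto (fun n => B n x) atTop (𝓝 c)}
      add_mem' := by
        rintro x y ⟨c, hc⟩ ⟨d, hd⟩
        exact ⟨c + d, by simpa using hc.add hd⟩
      zero_mem' := ⟨0, by simp⟩
      smul_mem' := by
        rintro a x ⟨c, hc⟩
        exact ⟨a • c, by simpa using hc.const_smul a⟩ }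
  toFun :=
    { toFun := fun x => limUnder atTop fun n => B n x
      map_add' := by
        rintro ⟨x, c, hc⟩ ⟨y, d, hd⟩
        have h : Tendsto (fun n => B n (x + y)) atTop (𝓝 (c + d)) := by simpa using hc.add hd
        simp only [Submodule.coe_add]
        rw [hc.limUnder_eq, hd.limUnder_eq, h.limUnder_eq]
      map_smul' := by
        rintro a ⟨x, c, hc⟩
        have h : Tendsto (fun n => B n (a • x)) atTop (𝓝 (a • c)) := by
          simpa using hc.const_smul a
        simp only [SetLike.val_smul, RingHom.id_apply]
        rw [hc.limUnder_eq, h.limUnder_eq] }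

theorem pointwiseLimit_eq {B : ℕ → H →L[ℝ] H} {x c : H}
    (h : Tendsto (fun n => B n x) atTop (𝓝 c)) :
    ∃ hx : x ∈ (pointwiseLimit B).domain, pointwiseLimit B ⟨x, hx⟩ = c :=
  ⟨⟨c, h⟩, h.limUnder_eq⟩

end PartialOperators

section Regression

variable {H : Type*} [NormedAddCommGroup H] [InnerProductSpace ℝ H] [MeasurableSpace H]
  [BorelSpace H] {Ω : Type*} [MeasurableSpace Ω] {Prob : Measure Ω}

theorem IsGaussianWith.memLp_two [CompleteSpace H] [SecondCountableTopology H] {X : Ω → H}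
    {m : H} {C : H →L[ℝ] H} (hX : Measurable X) (h : IsGaussianWith (Prob.map X) m C) : MemLp X 2 Prob := by
  have := h.gaussian
  exact (memLp_map_measure_iff aestronglyMeasurable_id hX.aemeasurable).1
    (IsGaussian.memLp_id (Prob.map X) 2 (by simp))

theorem IsGaussianWith.integral_inner_eq_zero {X : Ω → H} {C : H →L[ℝ] H} (hX : Measurable X)
    (h : IsGaussianWith (Prob.map X) 0 C) (l : H) : ∫ ω, inner ℝ l (X ω) ∂Prob = 0 := by
  have h1 := h.mean l
  rw [integral_map hX.aemeasurable (Continuous.aestronglyMeasurable (by fun_prop))] at h1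
  simpa using h1

theorem IsGaussianWith.inner_pairing_toLp {X : Ω → H} {C : H →L[ℝ] H} (hX : Measurable X)
    (h : IsGaussianWith (Prob.map X) 0 C) (hL : MemLp X 2 Prob) (k l : H) :
    inner ℝ (pairing Prob hL.toLp k) (pairing Prob hL.toLp l) = inner ℝ k (C l) := by
  have h1 := h.covariance k l
  rw [integral_map hX.aemeasurable (Continuous.aestronglyMeasurable (by fun_prop))] at h1
  rw [inner_pairing, ← h1]
  refine integral_congr_ae ?_
  filter_upwards [hL.coeFn_toLp] with ω hω
  simp [hω]

theorem isGaussianWith_zero_of_inner_pairing {X : Ω → H} {C : H →L[ℝ] H} (hX : Measurable X)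
    (hG : HasGaussianLaw X Prob) (F : Lp H 2 Prob) (hF : X =ᵐ[Prob] F)
    (hmean : ∀ l, ∫ ω, pairing Prob F l ω ∂Prob = 0)
    (hcov : ∀ k l, inner ℝ (pairing Prob F k) (pairing Prob F l) = inner ℝ k (C l)) :
    IsGaussianWith (Prob.map X) 0 C where
  gaussian := hG.isGaussian_map
  mean l := by
    rw [integral_map hX.aemeasurable (Continuous.aestronglyMeasurable (by fun_prop)),
      inner_zero_right, ← hmean l]
    refine integral_congr_ae ?_
    filter_upwards [hF, coeFn_pairing F l] with ω h1 h2
    rw [h1, h2]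
  covariance k l := by
    rw [integral_map hX.aemeasurable (Continuous.aestronglyMeasurable (by fun_prop)),
      ← hcov, inner_pairing]
    refine integral_congr_ae ?_
    filter_upwards [hF] with ω h1
    simp [h1]

variable [CompleteSpace H] [SecondCountableTopology H] [IsProbabilityMeasure Prob]

/-- **Gaussian regression.** For independent centred Gaussian vectors `ξ` and `η` with covariances
`P` and `Γ`, the gain `P (Γ + P)⁻¹` has a measurable linear extension `K` such that
`ξ - K (ξ + η)` is Gaussian and independent of `ξ + η`; its covariance is `P - K P`. The map `g`
extends `K` to a measurable function on the whole space. -/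
theorem exists_gaussian_regression {P Γ : H →L[ℝ] H} {ξ η : Ω → H} (hξm : Measurable ξ)
    (hηm : Measurable η) (hξ : IsGaussianWith (Prob.map ξ) 0 P)
    (hη : IsGaussianWith (Prob.map η) 0 Γ) (hξη : IndepFun ξ η Prob)
    (hinj : Function.Injective (Γ + P)) :
    ∃ (K : H →ₗ.[ℝ] H) (C' : H →L[ℝ] H) (g : H → H),
      IsMeasurableLinearExtension (Γ + P) (mulInv P (Γ + P)) K ∧
      Measurable g ∧ (∀ x : K.domain, K x = g x) ∧
      (∀ᵐ ω ∂Prob, ξ ω + η ω ∈ K.domain) ∧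
      (∀ x, ∃ h : P x ∈ K.domain, C' x = P x - K ⟨_, h⟩) ∧
      IndepFun (fun ω => ξ ω - g (ξ ω + η ω)) (fun ω => ξ ω + η ω) Prob ∧
      IsGaussianWith (Prob.map fun ω => ξ ω - g (ξ ω + η ω)) 0 C' := by
  have hξL := hξ.memLp_two hξm
  have hηL := hη.memLp_two hηm
  have hzL : MemLp (fun ω => ξ ω + η ω) 2 Prob := hξL.add hηL
  have hzm : Measurable fun ω => ξ ω + η ω := by fun_prop
  set Ξ : Lp H 2 Prob := hξL.toLp
  set E : Lp H 2 Prob := hηL.toLp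
  set Z : Lp H 2 Prob := hzL.toLp
  have hZadd : Z = Ξ + E := MemLp.toLp_add hξL hηL
  -- second moments of the pair
  have hΞΞ : ∀ k l, inner ℝ (pairing Prob Ξ k) (pairing Prob Ξ l) = inner ℝ k (P l) :=
    hξ.inner_pairing_toLp hξm hξL
  have hEE : ∀ k l, inner ℝ (pairing Prob E k) (pairing Prob E l) = inner ℝ k (Γ l) :=
    hη.inner_pairing_toLp hηm hηL
  have hΞE : ∀ k l, inner ℝ (pairing Prob Ξ k) (pairing Prob E l) = 0 := by
    intro k l
    have h1 : ∫ ω, inner ℝ k (ξ ω) * inner ℝ l (η ω) ∂Prob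
        = (∫ ω, inner ℝ k (ξ ω) ∂Prob) * ∫ ω, inner ℝ l (η ω) ∂Prob :=
      (hξη.comp (φ := fun x => inner ℝ k x) (ψ := fun x => inner ℝ l x)
        (by fun_prop) (by fun_prop)).integral_fun_mul_eq_mul_integral
        (by fun_prop) (by fun_prop)
    rw [hξ.integral_inner_eq_zero hξm, zero_mul] at h1
    rw [inner_pairing, ← h1]
    refine integral_congr_ae ?_
    filter_upwards [hξL.coeFn_toLp, hηL.coeFn_toLp] with ω h2 h3
    rw [h2, h3]
  have hEΞ : ∀ k l, inner ℝ (pairing Prob E k) (pairing Prob Ξ l) = 0 := fun k l => by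
    rw [real_inner_comm, hΞE]
  have hΞZ : ∀ k l, inner ℝ (pairing Prob Ξ k) (pairing Prob Z l) = inner ℝ k (P l) := by
    intro k l
    rw [hZadd, map_add, add_apply, inner_add_right, hΞΞ, hΞE, add_zero]
  have hZΞ : ∀ k l, inner ℝ (pairing Prob Z k) (pairing Prob Ξ l) = inner ℝ k (P l) := by
    intro k l
    rw [hZadd, map_add, add_apply, inner_add_left, hΞΞ, hEΞ, add_zero]
  have hZZ : ∀ k l, inner ℝ (pairing Prob Z k) (pairing Prob Z l) = inner ℝ k ((Γ + P) l) := by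
    intro k l
    rw [hZadd, map_add]
    simp only [add_apply, inner_add_left, inner_add_right]
    rw [hΞΞ, hEE, hΞE, hEΞ]
    ring
  -- the regression of `ξ` on `z`, and a subsequence along which it converges almost surely
  obtain ⟨N, B₀, hB₀, horth⟩ := exists_linear_regression Ξ Z
  obtain ⟨ns, hns, hae₀⟩ := (tendstoInMeasure_of_tendsto_Lp hB₀).exists_seq_tendsto_ae
  set B : ℕ → H →L[ℝ] H := fun j => B₀ (ns j)
  have hB : Tendsto (fun j => (B j).compLp Z) atTop (𝓝 N) := hB₀.comp hns.tendsto_atTop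
  have hae : ∀ᵐ ω ∂Prob, Tendsto (fun j => B j (ξ ω + η ω)) atTop (𝓝 (N ω)) := by
    have h1 : ∀ᵐ ω ∂Prob, ∀ j, (B j).compLp Z ω = B j (Z ω) :=
      ae_all_iff.2 fun j => (B j).coeFn_compLp Z
    filter_upwards [hae₀, h1, hzL.coeFn_toLp] with ω h2 h3 h4
    refine h2.congr fun j => ?_
    rw [← h4]
    exact h3 j
  have hpair : ∀ k, Tendsto (fun j => pairing Prob ((B j).compLp Z) k) atTop
      (𝓝 (pairing Prob N k)) := fun k =>
    ((show Continuous fun F => pairing Prob F k by fun_prop).tendsto N).comp hB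
  -- `F ↦ pairing F` is norm continuous, so the adjoints converge too
  have hadj : ∀ f, Tendsto (fun j =>
        ContinuousLinearMap.adjoint (pairing Prob ((B j).compLp Z)) f) atTop
      (𝓝 (ContinuousLinearMap.adjoint (pairing Prob N) f)) := fun f =>
    ((show Continuous fun F => ContinuousLinearMap.adjoint (pairing Prob F) f by
      fun_prop).tendsto N).comp hB
  have hNZ : ∀ k l, inner ℝ (pairing Prob N k) (pairing Prob Z l) = inner ℝ k (P l) := by
    intro k l
    have h := horth k l
    rw [map_sub, sub_apply, inner_sub_left, hΞZ] at h
    linarith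
  -- each component of `(B j) z` is a component of `z`, so the remainder is also orthogonal to `N`
  have hRN : ∀ k l, inner ℝ (pairing Prob (Ξ - N) k) (pairing Prob N l) = 0 := by
    intro k l
    have h : Tendsto (fun j => inner ℝ (pairing Prob (Ξ - N) k)
        (pairing Prob ((B j).compLp Z) l)) atTop
        (𝓝 (inner ℝ (pairing Prob (Ξ - N) k) (pairing Prob N l))) :=
      tendsto_const_nhds.inner (hpair l)
    simp_rw [pairing_compLp, horth] at h
    exact (tendsto_nhds_unique h tendsto_const_nhds)
  -- strong convergence on the range of `Γ + P` and on the range of `P`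
  have hBS : ∀ x, Tendsto (fun j => B j ((Γ + P) x)) atTop (𝓝 (P x)) := by
    intro x
    have h1 : ∀ j, B j ((Γ + P) x)
        = ContinuousLinearMap.adjoint (pairing Prob ((B j).compLp Z)) (pairing Prob Z x) := by
      intro j
      refine ext_inner_left ℝ fun k => ?_
      rw [ContinuousLinearMap.adjoint_inner_right, pairing_compLp, hZZ,
        ContinuousLinearMap.adjoint_inner_left]
    have h2 : P x = ContinuousLinearMap.adjoint (pairing Prob N) (pairing Prob Z x) := by
      refine ext_inner_left ℝ fun k => ?_
      rw [ContinuousLinearMap.adjoint_inner_right, hNZ]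
    simp_rw [h1, h2]
    exact hadj _
  let C' : H →L[ℝ] H :=
    (ContinuousLinearMap.adjoint (pairing Prob (Ξ - N))).comp (pairing Prob (Ξ - N))
  have hC' : ∀ k l, inner ℝ (pairing Prob (Ξ - N) k) (pairing Prob (Ξ - N) l)
      = inner ℝ k (C' l) := fun k l =>
    (ContinuousLinearMap.adjoint_inner_right (pairing Prob (Ξ - N)) k _).symm
  have hBP : ∀ x, Tendsto (fun j => B j (P x)) atTop (𝓝 (P x - C' x)) := by
    intro x
    have h1 : ∀ j, B j (P x)
        = ContinuousLinearMap.adjoint (pairing Prob ((B j).compLp Z)) (pairing Prob Ξ x) := by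
      intro j
      refine ext_inner_left ℝ fun k => ?_
      rw [ContinuousLinearMap.adjoint_inner_right, pairing_compLp, hZΞ,
        ContinuousLinearMap.adjoint_inner_left]
    have h2 : P x - C' x = ContinuousLinearMap.adjoint (pairing Prob N) (pairing Prob Ξ x) := by
      refine ext_inner_left ℝ fun k => ?_
      rw [ContinuousLinearMap.adjoint_inner_right, inner_sub_right, ← hC', ← hΞΞ,
        map_sub (pairing Prob) Ξ N, sub_apply, sub_apply, inner_sub_right,
        ← sub_apply, ← map_sub, hRN, sub_zero, map_sub, sub_apply, inner_sub_left]
      ring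
    simp_rw [h1, h2]
    exact hadj _
  let g : H → H := fun x => limUnder atTop fun j => B j x
  have hgm : Measurable g :=
    (StronglyMeasurable.limUnder (l := atTop) (f := fun j x => B j x) fun j =>
      (B j).continuous.stronglyMeasurable).measurable
  have hgN : (fun ω => ξ ω - g (ξ ω + η ω)) =ᵐ[Prob] (Ξ - N : Lp H 2 Prob) := by
    filter_upwards [hae, Lp.coeFn_sub Ξ N, hξL.coeFn_toLp] with ω h1 h2 h3
    rw [h2, Pi.sub_apply, h3]
    exact congrArg (ξ ω - ·) h1.limUnder_eq
  have hrm : Measurable fun ω => ξ ω - g (ξ ω + η ω) := by fun_prop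
  have hdom : ∀ᵐ ω ∂Prob, ξ ω + η ω ∈ (pointwiseLimit B).domain := by
    filter_upwards [hae] with ω hω
    exact ⟨_, hω⟩
  -- joint Gaussianity
  have hξG : HasGaussianLaw ξ Prob := ⟨hξ.gaussian⟩
  have hηG : HasGaussianLaw η Prob := ⟨hη.gaussian⟩
  have hpairG : HasGaussianLaw (fun ω => (ξ ω, η ω)) Prob := hξη.hasGaussianLaw hξG hηG
  have hcomb : ∀ k l, HasGaussianLaw (pairing Prob (Ξ - N) k + pairing Prob Z l : Lp ℝ 2 Prob)
      Prob := by
    intro k l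
    refine hasGaussianLaw_of_tendsto
      (f := fun j => pairing Prob (Ξ - (B j).compLp Z) k + pairing Prob Z l) (fun j => ?_) ?_
    · let T : H × H →L[ℝ] ℝ :=
        (innerSL ℝ k).comp (ContinuousLinearMap.fst ℝ H H
          - (B j).comp (ContinuousLinearMap.fst ℝ H H + ContinuousLinearMap.snd ℝ H H))
        + (innerSL ℝ l).comp (ContinuousLinearMap.fst ℝ H H + ContinuousLinearMap.snd ℝ H H)
      refine (hpairG.map_fun T).congr ?_
      filter_upwards [Lp.coeFn_add (pairing Prob (Ξ - (B j).compLp Z) k) (pairing Prob Z l),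
        coeFn_pairing (Ξ - (B j).compLp Z) k, coeFn_pairing Z l,
        Lp.coeFn_sub Ξ ((B j).compLp Z), (B j).coeFn_compLp Z, hξL.coeFn_toLp,
        hzL.coeFn_toLp] with ω h1 h2 h3 h4 h5 h6 h7
      rw [h1, Pi.add_apply, h2, h3, h4, Pi.sub_apply, h5, h6, h7]
      simp [T, inner_sub_right, inner_add_right]
    · refine Tendsto.add ?_ tendsto_const_nhds
      exact ((show Continuous fun F => pairing Prob F k by fun_prop).tendsto _).comp
        (tendsto_const_nhds.sub hB)
  have hjoint : HasGaussianLaw (fun ω => (ξ ω - g (ξ ω + η ω), ξ ω + η ω)) Prob := by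
    refine ⟨isGaussian_of_isGaussian_map fun T => ?_⟩
    rw [Measure.map_map (by fun_prop) (by fun_prop)]
    let k : H := (InnerProductSpace.toDual ℝ H).symm (T.comp (ContinuousLinearMap.inl ℝ H H))
    let l : H := (InnerProductSpace.toDual ℝ H).symm (T.comp (ContinuousLinearMap.inr ℝ H H))
    refine ((hcomb k l).congr ?_).isGaussian_map
    filter_upwards [Lp.coeFn_add (pairing Prob (Ξ - N) k) (pairing Prob Z l),
      coeFn_pairing (Ξ - N) k, coeFn_pairing Z l, hgN, hzL.coeFn_toLp] with ω h1 h2 h3 h4 h5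
    rw [h1, Pi.add_apply, h2, h3, ← h4, h5, InnerProductSpace.toDual_symm_apply,
      InnerProductSpace.toDual_symm_apply, Function.comp_apply, ContinuousLinearMap.comp_apply,
      ContinuousLinearMap.comp_apply, ← map_add]
    simp
  have hmeanZ : ∀ l, ∫ ω, inner ℝ l (ξ ω + η ω) ∂Prob = 0 := by
    intro l
    simp_rw [inner_add_right]
    rw [integral_add, hξ.integral_inner_eq_zero hξm, hη.integral_inner_eq_zero hηm, add_zero]
    · exact (hξL.integrable (by norm_num)).const_inner l
    · exact (hηL.integrable (by norm_num)).const_inner l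
  have hmeanR : ∀ l, ∫ ω, pairing Prob (Ξ - N) l ω ∂Prob = 0 := by
    intro l
    have h1 : Tendsto (fun j => ∫ ω, pairing Prob (Ξ - (B j).compLp Z) l ω ∂Prob) atTop
        (𝓝 (∫ ω, pairing Prob (Ξ - N) l ω ∂Prob)) :=
      ((continuous_integral_Lp_two.comp
        (show Continuous fun F => pairing Prob F l by fun_prop)).tendsto _).comp
        (tendsto_const_nhds.sub hB)
    have h2 : ∀ j, ∫ ω, pairing Prob (Ξ - (B j).compLp Z) l ω ∂Prob = 0 := by
      intro j
      have h3 : ∫ ω, pairing Prob (Ξ - (B j).compLp Z) l ω ∂Prob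
          = ∫ ω, (inner ℝ l (ξ ω)
            - inner ℝ (ContinuousLinearMap.adjoint (B j) l) (ξ ω + η ω)) ∂Prob := by
        refine integral_congr_ae ?_
        filter_upwards [coeFn_pairing (Ξ - (B j).compLp Z) l, Lp.coeFn_sub Ξ ((B j).compLp Z),
          (B j).coeFn_compLp Z, hξL.coeFn_toLp, hzL.coeFn_toLp] with ω h1 h2 h3 h4 h5
        rw [h1, h2, Pi.sub_apply, h3, h4, h5, inner_sub_right,
          ContinuousLinearMap.adjoint_inner_left]
      rw [h3, integral_sub, hmeanZ, hξ.integral_inner_eq_zero hξm, sub_zero]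
      · exact (hξL.integrable (by norm_num)).const_inner l
      · exact (hzL.integrable (by norm_num)).const_inner _
    simp_rw [h2] at h1
    exact tendsto_nhds_unique h1 tendsto_const_nhds
  have hZG : IsGaussianWith (Prob.map fun ω => ξ ω + η ω) 0 (Γ + P) := by
    refine isGaussianWith_zero_of_inner_pairing hzm hjoint.snd Z hzL.coeFn_toLp.symm
      (fun l => ?_) hZZ
    rw [← hmeanZ l]
    refine integral_congr_ae ?_
    filter_upwards [coeFn_pairing Z l, hzL.coeFn_toLp] with ω h1 h2
    rw [h1, h2]
  have hmdom : MeasurableSet ((pointwiseLimit B).domain : Set H) :=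
    measurableSet_exists_tendsto (l := atTop) (f := fun j x => B j x) fun j =>
      (B j).continuous.measurable
  refine ⟨pointwiseLimit B, C', g, ⟨mulInv_le hinj fun x => pointwiseLimit_eq (hBS x), hmdom,
    hgm.comp measurable_subtype_coe, _, hZG, ?_⟩, hgm, fun x => rfl, hdom, fun x => ?_, ?_, ?_⟩
  · rw [Measure.map_apply hzm hmdom.compl]
    exact hdom
  · obtain ⟨h1, h2⟩ := pointwiseLimit_eq (hBP x)
    exact ⟨h1, by rw [h2]; abel⟩
  · refine hjoint.indepFun_of_covariance_inner fun k l => ?_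
    rw [covariance_eq_sub, hmeanZ, mul_zero, sub_zero, ← horth k l, inner_pairing]
    · refine integral_congr_ae ?_
      filter_upwards [hgN, hzL.coeFn_toLp] with ω h1 h2
      simp only [Pi.mul_apply]
      rw [h1, ← h2]
    · exact (hjoint.fst.memLp_two).const_inner k
    · exact hzL.const_inner l
  · exact isGaussianWith_zero_of_inner_pairing hrm hjoint.fst _ hgN hmeanR hC'

end Regression

end KalmanFilter

/-! ### The filtering recursion -/

namespace KalmanFilter

section Evolution

variable {H : Type*} [NormedAddCommGroup H] [InnerProductSpace ℝ H]

theorem solutionOperator_zero (L : H →ₗ.[ℝ] H) :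
    solutionOperator L 0 = ContinuousLinearMap.id ℝ H := by
  unfold solutionOperator
  split_ifs with h
  · exact h.choose_spec.zero
  · rfl

/-- The semigroup law. It also holds for the default value of `solutionOperator`, the constant
family `id`, so both branches of the definition are covered. -/
theorem solutionOperator_add (L : H →ₗ.[ℝ] H) {s t : ℝ} (hs : 0 ≤ s) (ht : 0 ≤ t) :
    solutionOperator L (s + t) = (solutionOperator L s).comp (solutionOperator L t) := by
  unfold solutionOperator
  split_ifs with h
  · exact h.choose_spec.add s t hs ht
  · rfl

theorem signal_zero {Ω : Type*} (L : H →ₗ.[ℝ] H) (Δt : ℝ) (v₀ : Ω → H) :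
    signal L Δt v₀ 0 = v₀ := by
  funext ω
  simp [signal, solutionOperator_zero]

theorem signal_succ {Ω : Type*} (L : H →ₗ.[ℝ] H) {Δt : ℝ} (hΔt : 0 ≤ Δt) (v₀ : Ω → H) (n : ℕ)
    (ω : Ω) : signal L Δt v₀ (n + 1) ω = solutionOperator L Δt (signal L Δt v₀ n ω) := by
  have h : ((n + 1 : ℕ) : ℝ) * Δt = Δt + n * Δt := by
    push_cast
    ring
  rw [signal, h, solutionOperator_add L hΔt (by positivity)]
  rfl

end Evolution

section GaussianTransformations

variable {H : Type*} [NormedAddCommGroup H] [InnerProductSpace ℝ H] [MeasurableSpace H]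

theorem IsGaussianWith.inner_self_nonneg {μ : Measure H} {m : H} {C : H →L[ℝ] H}
    (h : IsGaussianWith μ m C) (x : H) : 0 ≤ inner ℝ x (C x) := by
  rw [← h.covariance x x]
  exact integral_nonneg fun y => mul_self_nonneg _

theorem IsStrictlyPositive.injective_add {μ : Measure H} {m : H} {Γ P : H →L[ℝ] H}
    (hΓ : IsStrictlyPositive Γ) (hP : IsGaussianWith μ m P) : Function.Injective (Γ + P) := by
  refine (injective_iff_map_eq_zero _).2 fun x hx => ?_
  by_contra hne
  have h1 := hΓ x hne
  have h2 := hP.inner_self_nonneg x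
  have h3 : inner ℝ x ((Γ + P) x) = 0 := by rw [hx, inner_zero_right]
  rw [add_apply, inner_add_right, real_inner_comm] at h3
  linarith

variable [CompleteSpace H] [BorelSpace H]

theorem IsGaussianWith.map_clm {μ : Measure H} {C : H →L[ℝ] H} (h : IsGaussianWith μ 0 C)
    (U : H →L[ℝ] H) :
    IsGaussianWith (μ.map U) 0 (U.comp (C.comp (ContinuousLinearMap.adjoint U))) := by
  have := h.gaussian
  refine ⟨inferInstance, fun l => ?_, fun k l => ?_⟩
  · rw [integral_map (by fun_prop) (Continuous.aestronglyMeasurable (by fun_prop))]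
    simp_rw [← ContinuousLinearMap.adjoint_inner_left]
    rw [h.mean, inner_zero_right, inner_zero_right]
  · rw [integral_map (by fun_prop) (Continuous.aestronglyMeasurable (by fun_prop))]
    simp only [sub_zero, ContinuousLinearMap.comp_apply]
    have h1 := h.covariance (ContinuousLinearMap.adjoint U k) (ContinuousLinearMap.adjoint U l)
    simp only [sub_zero, ContinuousLinearMap.adjoint_inner_left] at h1
    exact h1

variable [SecondCountableTopology H]

theorem IsGaussianWith.map_const_add {μ : Measure H} {m : H} {C : H →L[ℝ] H}
    (h : IsGaussianWith μ m C) (c : H) : IsGaussianWith (μ.map fun x => c + x) (c + m) C := by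
  have := h.gaussian
  refine ⟨inferInstance, fun l => ?_, fun k l => ?_⟩
  · rw [integral_map (by fun_prop) (Continuous.aestronglyMeasurable (by fun_prop))]
    simp_rw [inner_add_right]
    rw [integral_add (integrable_const _) (IsGaussian.integrable_id.const_inner l)]
    simp [h.mean]
  · rw [integral_map (by fun_prop) (Continuous.aestronglyMeasurable (by fun_prop)),
      ← h.covariance k l]
    simp

end GaussianTransformations

section Filter

variable {H : Type*} [NormedAddCommGroup H] [InnerProductSpace ℝ H] [MeasurableSpace H]
variable {Ω : Type*} [MeasurableSpace Ω] {Prob : Measure Ω}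

/-- `m` and `C` describe the filtering distribution at time `t_n`: the error `v_n - m(Y_n)` is
independent of the data `Y_n`, with law `N(0, C)`. -/
structure IsFilterAt (Prob : Measure Ω) (L : H →ₗ.[ℝ] H) (Δt : ℝ) (v₀ : Ω → H) (η : ℕ → Ω → H)
    (n : ℕ) (m : (Fin n → H) → H) (C : H →L[ℝ] H) : Prop where
  measurable_mean : Measurable m
  indepFun : IndepFun (fun ω => signal L Δt v₀ n ω - m (data L Δt v₀ η n ω))
    (data L Δt v₀ η n) Prob
  gaussian : IsGaussianWith
    (Prob.map fun ω => signal L Δt v₀ n ω - m (data L Δt v₀ η n ω)) 0 C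

variable (L : H →ₗ.[ℝ] H) (Δt : ℝ) {v₀ : Ω → H} {η : ℕ → Ω → H}

variable [BorelSpace H]

theorem measurable_signal (hv₀ : Measurable v₀) (n : ℕ) : Measurable (signal L Δt v₀ n) :=
  (solutionOperator L (n * Δt)).measurable.comp hv₀

variable [SecondCountableTopology H]

theorem measurable_data (hv₀ : Measurable v₀) (hη : ∀ n, Measurable (η n)) (n : ℕ) :
    Measurable (data L Δt v₀ η n) :=
  measurable_pi_iff.2 fun i => (measurable_signal L Δt hv₀ (i + 1)).add (hη (i + 1))

variable [IsProbabilityMeasure Prob]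

/-- The noise in the next observation is independent of the current signal and data. -/
theorem indepFun_signal_data_noise (hv₀ : Measurable v₀) (hη : ∀ n, Measurable (η n))
    (hη_indep : iIndepFun η Prob) (hv₀η : IndepFun v₀ (fun ω n => η n ω) Prob) (n : ℕ) :
    IndepFun (fun ω => (signal L Δt v₀ n ω, data L Δt v₀ η n ω)) (η (n + 1)) Prob := by
  let past : Ω → Finset.range (n + 1) → H := fun ω i => η i ω
  have hpast : Measurable past := measurable_pi_iff.2 fun i => hη i
  have h1 : IndepFun (η (n + 1)) past Prob :=
    (hη_indep.indepFun_finset {n + 1} (Finset.range (n + 1)) (by simp) hη).comp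
      (φ := fun p : ({n + 1} : Finset ℕ) → H => p ⟨n + 1, Finset.mem_singleton_self _⟩)
      (ψ := id) (by fun_prop) measurable_id
  have h2 : IndepFun (fun ω => (η (n + 1) ω, past ω)) v₀ Prob :=
    hv₀η.symm.comp (φ := fun x : ℕ → H => (x (n + 1), fun i : Finset.range (n + 1) => x i))
      (ψ := id) (by fun_prop) measurable_id
  have h3 := indepFun_prodMk_assoc (hη (n + 1)) hpast hv₀ h1 h2
  let φ : (Finset.range (n + 1) → H) × H → H × (Fin n → H) := fun p =>
    (solutionOperator L (n * Δt) p.2, fun i =>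
      solutionOperator L ((i + 1 : ℕ) * Δt) p.2 + p.1 ⟨i + 1, by simp⟩)
  have hφ : Measurable φ := by fun_prop
  exact h3.symm.comp hφ measurable_id

variable [CompleteSpace H]

theorem isFilterAt_zero (hv₀ : Measurable v₀) {m₀ : H} {C₀ : H →L[ℝ] H}
    (h : IsGaussianWith (Prob.map v₀) m₀ C₀) :
    IsFilterAt Prob L Δt v₀ η 0 (fun _ => m₀) C₀ where
  measurable_mean := measurable_const
  indepFun := by
    have hconst : data L Δt v₀ η 0 = fun _ => Fin.elim0 := by
      funext ω
      exact Subsingleton.elim _ _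
    rw [hconst]
    exact indepFun_const_right _ _
  gaussian := by
    rw [signal_zero]
    have h1 := h.map_const_add (-m₀)
    rw [Measure.map_map (by fun_prop) hv₀, neg_add_cancel] at h1
    convert h1 using 2
    funext ω
    simp [sub_eq_neg_add]

theorem IsFilterAt.condDistrib {L : H →ₗ.[ℝ] H} {Δt : ℝ} {n : ℕ} {m : (Fin n → H) → H}
    {C : H →L[ℝ] H} (h : IsFilterAt Prob L Δt v₀ η n m C) (hv₀ : Measurable v₀)
    (hη : ∀ n, Measurable (η n)) :
    ∀ᵐ ω ∂Prob, IsGaussianWith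
      (condDistrib (signal L Δt v₀ n) (data L Δt v₀ η n) Prob (data L Δt v₀ η n ω))
      (m (data L Δt v₀ η n ω)) C := by
  have hm := h.measurable_mean
  have hs := measurable_signal L Δt hv₀ n
  have hd := measurable_data L Δt hv₀ hη n
  filter_upwards [condDistrib_ae_eq_map_add (X := signal L Δt v₀ n) hd
    (hs.sub (hm.comp hd)) hm (fun ω => by simp) h.indepFun] with ω hω
  rw [hω]
  have h1 := h.gaussian.map_const_add (m (data L Δt v₀ η n ω))
  rwa [add_zero] at h1

/-- One step of the filter: prediction by the solution operator, then Gaussian regression of the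
predicted error on the innovation `y_{n+1} - e^{-Δt L} m(Y_n)`. -/
theorem IsFilterAt.exists_succ {L : H →ₗ.[ℝ] H} {Δt : ℝ} {n : ℕ} {m : (Fin n → H) → H}
    {C Γ : H →L[ℝ] H} (h : IsFilterAt Prob L Δt v₀ η n m C) (hΔt : 0 ≤ Δt)
    (hΓ : IsStrictlyPositive Γ) (hv₀ : Measurable v₀) (hη : ∀ n, Measurable (η n))
    (hηΓ : IsGaussianWith (Prob.map (η (n + 1))) 0 Γ) (hη_indep : iIndepFun η Prob)
    (hv₀η : IndepFun v₀ (fun ω n => η n ω) Prob) :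
    ∃ (m' : (Fin (n + 1) → H) → H) (C' : H →L[ℝ] H), IsFilterAt Prob L Δt v₀ η (n + 1) m' C' ∧
      ∃ K : H →ₗ.[ℝ] H,
        IsMeasurableLinearExtension (Γ + predictedCov L Δt C)
          (mulInv (predictedCov L Δt C) (Γ + predictedCov L Δt C)) K ∧
        (∀ᵐ ω ∂Prob, ∃ h : solutionOperator L Δt (m (data L Δt v₀ η n ω))
              - observation L Δt v₀ η (n + 1) ω ∈ K.domain,
          m' (data L Δt v₀ η (n + 1) ω) =
            solutionOperator L Δt (m (data L Δt v₀ η n ω)) - K ⟨_, h⟩) ∧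
        ∀ x, ∃ h : predictedCov L Δt C x ∈ K.domain,
          C' x = predictedCov L Δt C x - K ⟨_, h⟩ := by
  set U := solutionOperator L Δt with hU
  set Y := data L Δt v₀ η n with hY
  have hm := h.measurable_mean
  have hs := measurable_signal L Δt hv₀ n
  have hd : Measurable Y := measurable_data L Δt hv₀ hη n
  let r : Ω → H := fun ω => signal L Δt v₀ n ω - m (Y ω)
  have hr : Measurable r := hs.sub (hm.comp hd)
  let ξ : Ω → H := fun ω => U (r ω)
  have hξ : Measurable ξ := U.measurable.comp hr
  have hξG : IsGaussianWith (Prob.map ξ) 0 (predictedCov L Δt C) := by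
    have h1 := h.gaussian.map_clm U
    rwa [Measure.map_map U.measurable hr] at h1
  -- the predicted error and the new noise are independent of each other and of the old data
  have hYξ : IndepFun Y ξ Prob := (h.indepFun.comp U.measurable measurable_id).symm
  have hYξη : IndepFun (fun ω => (Y ω, ξ ω)) (η (n + 1)) Prob :=
    (indepFun_signal_data_noise L Δt hv₀ hη hη_indep hv₀η n).comp
      (φ := fun p : H × (Fin n → H) => (p.2, U (p.1 - m p.2))) (ψ := id)
      (by fun_prop) measurable_id
  have hξη : IndepFun ξ (η (n + 1)) Prob := hYξη.comp measurable_snd measurable_id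
  have hYjoint := indepFun_prodMk_assoc hd hξ (hη (n + 1)) hYξ hYξη
  obtain ⟨K, C', g, hK, hg, hKg, hKdom, hKC, hgi, hgG⟩ :=
    exists_gaussian_regression hξ (hη (n + 1)) hξG hηΓ hξη (hΓ.injective_add hξG)
  -- With the innovation `y - U m` in place of its negative, `m'` agrees with the Kalman update as `K`
  -- is linear, and the new error equals `ξ - g (ξ + η)` everywhere.
  let m' : (Fin (n + 1) → H) → H := fun y =>
    U (m (Fin.init y)) + g (y (Fin.last n) - U (m (Fin.init y)))
  have hinit : Measurable fun y : Fin (n + 1) → H => (Fin.init y : Fin n → H) :=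
    measurable_pi_iff.2 fun i => measurable_pi_apply i.castSucc
  have hm' : Measurable m' := by fun_prop
  -- the innovation is the sum of the predicted error and the new noise
  have hinnov : ∀ ω, observation L Δt v₀ η (n + 1) ω - U (m (Y ω)) = ξ ω + η (n + 1) ω := by
    intro ω
    simp only [observation, signal_succ L hΔt, ξ, r, map_sub]
    abel
  have hm'data : ∀ ω, m' (data L Δt v₀ η (n + 1) ω) = U (m (Y ω)) + g (ξ ω + η (n + 1) ω) := by
    intro ω
    rw [← hinnov]
    rfl
  have herr : (fun ω => signal L Δt v₀ (n + 1) ω - m' (data L Δt v₀ η (n + 1) ω))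
      = fun ω => ξ ω - g (ξ ω + η (n + 1) ω) := by
    funext ω
    rw [hm'data, signal_succ L hΔt]
    simp only [ξ, r, map_sub]
    abel
  have hdata : data L Δt v₀ η (n + 1)
      = fun ω => Fin.snoc (α := fun _ => H) (Y ω) (ξ ω + η (n + 1) ω + U (m (Y ω))) := by
    funext ω
    rw [← hinnov, sub_add_cancel]
    exact (Fin.snoc_init_self (data L Δt v₀ η (n + 1) ω)).symm
  have hsnoc : Measurable fun p : H × (Fin n → H) =>
      (Fin.snoc (α := fun _ => H) p.2 (p.1 + U (m p.2)) : Fin (n + 1) → H) := by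
    refine measurable_pi_iff.2 fun i => ?_
    induction i using Fin.lastCases with
    | last => simp only [Fin.snoc_last]; fun_prop
    | cast i => simp only [Fin.snoc_castSucc]; fun_prop
  have hnew : IndepFun (fun ω => ξ ω - g (ξ ω + η (n + 1) ω)) (data L Δt v₀ η (n + 1)) Prob := by
    have h1 : IndepFun (fun ω => (ξ ω - g (ξ ω + η (n + 1) ω), ξ ω + η (n + 1) ω)) Y Prob :=
      hYjoint.symm.comp (φ := fun p : H × H => (p.1 - g (p.1 + p.2), p.1 + p.2)) (ψ := id)
        (by fun_prop) measurable_id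
    have h2 := indepFun_prodMk_assoc (by have := hη (n + 1); fun_prop)
      (hξ.add (hη (n + 1))) hd hgi h1
    rw [hdata]
    exact h2.comp measurable_id hsnoc
  refine ⟨m', C', ⟨hm', ?_, ?_⟩, K, hK, ?_, hKC⟩
  · rw [herr]
    exact hnew
  · rw [herr]
    exact hgG
  · filter_upwards [hKdom] with ω hω
    have hneg : U (m (Y ω)) - observation L Δt v₀ η (n + 1) ω = -(ξ ω + η (n + 1) ω) := by
      rw [← hinnov, neg_sub]
    have hmem : U (m (Y ω)) - observation L Δt v₀ η (n + 1) ω ∈ K.domain := by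
      rw [hneg]
      exact K.domain.neg_mem hω
    refine ⟨hmem, ?_⟩
    have hsub : (⟨_, hmem⟩ : K.domain) = -⟨_, hω⟩ := Subtype.ext hneg
    rw [hm'data, hsub, LinearPMap.map_neg, sub_neg_eq_add, hKg]

end Filter

end KalmanFilter

theorem theorem2p1 {Ω : Type*} [MeasurableSpace Ω] (Prob : Measure Ω) [IsProbabilityMeasure Prob]
    (L : KalmanFilter.L2Torus →ₗ.[ℝ] KalmanFilter.L2Torus)
    (hL : KalmanFilter.IsAntiHermitian L)
    (Δt : ℝ) (hΔt : 0 < Δt)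
    (m₀ : KalmanFilter.L2Torus)
    (C₀ Γ : KalmanFilter.L2Torus →L[ℝ] KalmanFilter.L2Torus)
    (hC₀ : KalmanFilter.IsStrictlyPositive C₀) (hΓ : KalmanFilter.IsStrictlyPositive Γ)
    (v₀ : Ω → KalmanFilter.L2Torus) (η : ℕ → Ω → KalmanFilter.L2Torus)
    (hv₀_meas : Measurable v₀) (hη_meas : ∀ n, Measurable (η n))
    (hv₀ : KalmanFilter.IsGaussianWith (Prob.map v₀) m₀ C₀)
    (hη : ∀ n, KalmanFilter.IsGaussianWith (Prob.map (η n)) 0 Γ)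
    (hη_indep : iIndepFun η Prob)
    (hv₀η_indep : IndepFun v₀ (fun ω n => η n ω) Prob) :
    ∃ (m : (n : ℕ) → (Fin n → KalmanFilter.L2Torus) → KalmanFilter.L2Torus)
      (C : ℕ → KalmanFilter.L2Torus →L[ℝ] KalmanFilter.L2Torus),
      (∀ n, Measurable (m n)) ∧
      -- the filtering distribution is Gaussian with mean `m n` and covariance `C n`
      (∀ n, ∀ᵐ ω ∂Prob, KalmanFilter.IsGaussianWith
        (condDistrib (KalmanFilter.signal L Δt v₀ n) (KalmanFilter.data L Δt v₀ η n) Prob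
          (KalmanFilter.data L Δt v₀ η n ω))
        (m n (KalmanFilter.data L Δt v₀ η n ω)) (C n)) ∧
      -- initial values of the recursion
      (∀ Y : Fin 0 → KalmanFilter.L2Torus, m 0 Y = m₀) ∧ C 0 = C₀ ∧
      -- the recursion; `K` is the operator `P (Γ + P)⁻¹`, extended to a set of full measure
      ∀ n, ∃ K : KalmanFilter.L2Torus →ₗ.[ℝ] KalmanFilter.L2Torus,
        KalmanFilter.IsMeasurableLinearExtension
          (Γ + KalmanFilter.predictedCov L Δt (C n))
          (KalmanFilter.mulInv (KalmanFilter.predictedCov L Δt (C n))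
            (Γ + KalmanFilter.predictedCov L Δt (C n))) K ∧
        (∀ᵐ ω ∂Prob, ∃ h : KalmanFilter.solutionOperator L Δt (m n (KalmanFilter.data L Δt v₀ η n ω))
              - KalmanFilter.observation L Δt v₀ η (n + 1) ω ∈ K.domain,
          m (n + 1) (KalmanFilter.data L Δt v₀ η (n + 1) ω) =
            KalmanFilter.solutionOperator L Δt (m n (KalmanFilter.data L Δt v₀ η n ω))
              - K ⟨_, h⟩) ∧
        ∀ x, ∃ h : KalmanFilter.predictedCov L Δt (C n) x ∈ K.domain,
          C (n + 1) x = KalmanFilter.predictedCov L Δt (C n) x - K ⟨_, h⟩ := by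
  -- The filters are chosen successively: at each time the mean and the covariance are bundled with
  -- the invariant that the next step needs.
  obtain ⟨F, hF0, hFS⟩ : ∃ F : (n : ℕ) → {p : ((Fin n → KalmanFilter.L2Torus) →
      KalmanFilter.L2Torus) × (KalmanFilter.L2Torus →L[ℝ] KalmanFilter.L2Torus) //
        KalmanFilter.IsFilterAt Prob L Δt v₀ η n p.1 p.2},
      F 0 = ⟨(fun _ => m₀, C₀), KalmanFilter.isFilterAt_zero L Δt hv₀_meas hv₀⟩ ∧
      ∀ n, ∃ K : KalmanFilter.L2Torus →ₗ.[ℝ] KalmanFilter.L2Torus,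
        KalmanFilter.IsMeasurableLinearExtension
          (Γ + KalmanFilter.predictedCov L Δt (F n).1.2)
          (KalmanFilter.mulInv (KalmanFilter.predictedCov L Δt (F n).1.2)
            (Γ + KalmanFilter.predictedCov L Δt (F n).1.2)) K ∧
        (∀ᵐ ω ∂Prob, ∃ h : KalmanFilter.solutionOperator L Δt
                ((F n).1.1 (KalmanFilter.data L Δt v₀ η n ω))
              - KalmanFilter.observation L Δt v₀ η (n + 1) ω ∈ K.domain,
          (F (n + 1)).1.1 (KalmanFilter.data L Δt v₀ η (n + 1) ω) =
            KalmanFilter.solutionOperator L Δt ((F n).1.1 (KalmanFilter.data L Δt v₀ η n ω))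
              - K ⟨_, h⟩) ∧
        ∀ x, ∃ h : KalmanFilter.predictedCov L Δt (F n).1.2 x ∈ K.domain,
          (F (n + 1)).1.2 x = KalmanFilter.predictedCov L Δt (F n).1.2 x - K ⟨_, h⟩ := by
    choose m' C' hstep hrec using fun (n : ℕ) (p : {p : ((Fin n → KalmanFilter.L2Torus) →
        KalmanFilter.L2Torus) × (KalmanFilter.L2Torus →L[ℝ] KalmanFilter.L2Torus) //
          KalmanFilter.IsFilterAt Prob L Δt v₀ η n p.1 p.2}) =>
      p.2.exists_succ hΔt.le hΓ hv₀_meas hη_meas (hη (n + 1)) hη_indep hv₀η_indep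
    exact ⟨fun n => Nat.rec ⟨(fun _ => m₀, C₀), KalmanFilter.isFilterAt_zero L Δt hv₀_meas hv₀⟩
      (fun n p => ⟨(m' n p, C' n p), hstep n p⟩) n, rfl, fun n => hrec n _⟩
  refine ⟨fun n => (F n).1.1, fun n => (F n).1.2, fun n => (F n).2.measurable_mean,
    fun n => (F n).2.condDistrib hv₀_meas hη_meas, fun Y => ?_, ?_, hFS⟩
  · simp only [hF0]
  · simp only [hF0]
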